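/- **Setting.** Let $\Omega\subset\mathbb R^3$ be a bounded domain, $W^0=W^3=L^2(\Omega)$, $W^1=W^2=L^2(\Omega)^3$, with $L^2$ inner product $\langle\cdot,\cdot\rangle$ and norm $\|\cdot\|$. Let $V^0\to V^1\to V^2\to V^3=W^3$ be a de Rham complex on $\Omega$: $d^0,d^1,d^2$ are the weak gradient, curl and divergence restricted to domains $V^k\subset W^k$ that contain $C_c^\infty(\Omega)$, the operators $d^k$ with domain $V^k$ are closed and densely defined, $dV^k\subset V^{k+1}$ and $d\circ d=0$; put $d^3=0$ (the choice of the $V^k$ encodes the boundary conditions). Let $V^*_k$ be the domain of the adjoint $d^*$ of $d^{k-1}$, and assume that the inclusions $V^k\cap V_k^*\subset W^k$, with the norm $\|w\|+\|dw\|+\|d^*w\|$, are compact for $k=1,2,3$. Write $\|v\|_{V}=\|v\|+\|dv\|$, $\mathfrak Z^k=\ker d^k$, $\mathfrak B^k=dV^{k-1}$, $\mathfrak H^k=\mathfrak Z^k\cap(\mathfrak B^k)^\perp$, and let $P_{\mathfrak B}$ be the $L^2$-orthogonal projection onto $\mathfrak B^k$. Let $c_p$ be the best constant with $\|z\|_V\le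 c_p\|dz\|$ for all $z\in V^k\cap(\mathfrak Z^k)^\perp$, $k=1,2$. Let $V_h^k\subset V^k$ ($k=1,2,3$) be finite-dimensional subspaces with $dV_h^k\subset V_h^{k+1}$, and let $\pi_h^k:V^k\to V^k_h$ be linear projections onto $V_h^k$ with $d\pi_h=\pi_h d$ and $\|\pi_h^kv\|\le M\|v\|$ for all $v\in V^k$. Put $\mathfrak H_h^k=\{v\in V_h^k: dv=0,\ v\perp dV_h^{k-1}\}$ for $k=2,3$, $E(\sigma)=\inf_{\tau\in V_h^k}\|\sigma-\tau\|$ for $\sigma \in V^k$, and $$\mu=\max_{k\in\{2,3\}}\ \sup_{r\in\mathfrak H^k,\ \|r\|=1}\|(I-\pi_h^k)r\|$$ (a supremum over the empty set being $0$). For $\nu>0$ let $$\begin{aligned}B_0(&(u_1,u_2,u_3,\phi_2,\phi_3),(v_1,v_2,v_3,\chi_2,\chi_3))=\langle u_1,v_1\rangle-\langle u_2,dv_1\rangle+\nu\langle du_1,v_2\rangle-\langle u_3,dv_2\rangle\\&+\langle\phi_2,v_2\rangle+\langle du_2,v_3\rangle+\langle\phi_3,v_3\rangle+\langle u_2,\chi_2\rangle+\langle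 u_3,\chi_3\rangle.\end{aligned}$$ **Theorem.** Let $(f_2,f_3)\in W^2\times W^3$. Let $(u_1,u_2,u_3,\phi_2,\phi_3)\in V^1\times V^2\times V^3\times\mathfrak H^2\times\mathfrak H^3$ be the solution of $$B_0((u_1,u_2,u_3,\phi_2,\phi_3),(v_1,v_2,v_3,\chi_2,\chi_3))=\langle f_2,v_2\rangle+\langle f_3,v_3\rangle$$ for all $(v_1,v_2,v_3,\chi_2,\chi_3)\in V^1\times V^2\times V^3\times\mathfrak H^2\times\mathfrak H^3$, and let $(u_{1h},u_{2h},u_{3h},\phi_{2h},\phi_{3h})\in V_h^1\times V_h^2\times V_h^3\times\mathfrak H_h^2\times\mathfrak H_h^3$ be the solution of the same equation for all test functions in $V_h^1\times V_h^2\times V_h^3\times\mathfrak H_h^2\times\mathfrak H_h^3$. Then $$\begin{aligned}&\|u_1-u_{1h}\|_V+\|u_2-u_{2h}\|_V+\|u_3-u_{3h}\|+\|\phi_2-\phi_{2h}\|+\|\phi_3-\phi_{3h}\|\\&\le K\Big(\inf_{v_1\in V_h^1}\|u_1-v_1\|_V+\inf_{v_2\in V_h^2}\|u_2-v_2\|_V+E(u_3)+E(\phi_2)+E(\phi_3)+\mu\big(E(P_{\mathfrak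 B}u_2)+E(P_{\mathfrak B}u_3)\big)\Big),\end{aligned}$$ where $K>0$ depends only on $\nu$ and on upper bounds $\kappa \ge c_p$ and $M$ for the Poincaré constant and the $W$-norms of the projections; in particular $K$ does not depend on $h$ or on the data. -/

import Mathlib

open MeasureTheory
open scoped ContDiff

noncomputable section

/-! ### Hilbert complexes -/

/-- A Hilbert complex `W₀ → W₁ → W₂ → W₃`: closed densely defined unbounded operators `d⁰, d¹, d²`
with `d ∘ d = 0`. The domain of `dᵏ` is the space `Vᵏ`; in the top degree `V³ = W₃` and `d³ = 0`. -/
structure HilbertComplex (W₀ W₁ W₂ W₃ : Type*)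
    [NormedAddCommGroup W₀] [InnerProductSpace ℝ W₀]
    [NormedAddCommGroup W₁] [InnerProductSpace ℝ W₁]
    [NormedAddCommGroup W₂] [InnerProductSpace ℝ W₂]
    [NormedAddCommGroup W₃] [InnerProductSpace ℝ W₃] where
  d0 : W₀ →ₗ.[ℝ] W₁
  d1 : W₁ →ₗ.[ℝ] W₂
  d2 : W₂ →ₗ.[ℝ] W₃
  dense_d0 : Dense (d0.domain : Set W₀)
  dense_d1 : Dense (d1.domain : Set W₁)
  dense_d2 : Dense (d2.domain : Set W₂)
  closed_d0 : d0.IsClosed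
  closed_d1 : d1.IsClosed
  closed_d2 : d2.IsClosed
  d0_mem : ∀ u : d0.domain, d0 u ∈ d1.domain
  d1_mem : ∀ u : d1.domain, d1 u ∈ d2.domain
  d1_d0 : ∀ u : d0.domain, d1 ⟨d0 u, d0_mem u⟩ = 0
  d2_d1 : ∀ u : d1.domain, d2 ⟨d1 u, d1_mem u⟩ = 0

/-- The `V`-norm `‖x‖ + ‖T x‖` on the domain of `T`. -/
def vNorm {E F : Type*} [NormedAddCommGroup E] [InnerProductSpace ℝ E]
    [NormedAddCommGroup F] [InnerProductSpace ℝ F] (T : E →ₗ.[ℝ] F) (x : T.domain) : ℝ :=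
  ‖(x : E)‖ + ‖T x‖

/-- Compactness of the inclusion `V ∩ V* ⊂ W`, where `V` is the domain of `T` and `V*` the domain of
the adjoint of `S`: the unit ball for the norm `‖w‖ + ‖T w‖ + ‖S† w‖` is relatively compact. -/
def CompactInclusion {E F G : Type*} [NormedAddCommGroup E] [InnerProductSpace ℝ E]
    [NormedAddCommGroup F] [InnerProductSpace ℝ F] [CompleteSpace E]
    [NormedAddCommGroup G] [InnerProductSpace ℝ G]
    (S : E →ₗ.[ℝ] F) (T : F →ₗ.[ℝ] G) : Prop :=
  IsCompact (closure {w : F | ∃ (h : w ∈ T.domain) (h' : w ∈ S.adjoint.domain),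
    ‖w‖ + ‖T ⟨w, h⟩‖ + ‖S.adjoint ⟨w, h'⟩‖ ≤ 1})

/-- The inequality `‖z‖_V ≤ c ‖T z‖` for all `z` in the domain of `T` orthogonal to the kernel. -/
def PoincareIneq {E F : Type*} [NormedAddCommGroup E] [InnerProductSpace ℝ E]
    [NormedAddCommGroup F] [InnerProductSpace ℝ F] (T : E →ₗ.[ℝ] F) (c : ℝ) : Prop :=
  ∀ z : T.domain, (∀ w : T.domain, T w = 0 → inner ℝ (w : E) (z : E) = 0) →
    vNorm T z ≤ c * ‖T z‖

namespace HilbertComplex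

variable {W₀ W₁ W₂ W₃ : Type*}
  [NormedAddCommGroup W₀] [InnerProductSpace ℝ W₀] [CompleteSpace W₀]
  [NormedAddCommGroup W₁] [InnerProductSpace ℝ W₁] [CompleteSpace W₁]
  [NormedAddCommGroup W₂] [InnerProductSpace ℝ W₂] [CompleteSpace W₂]
  [NormedAddCommGroup W₃] [InnerProductSpace ℝ W₃] [CompleteSpace W₃]

/-- `d¹` as a map `V¹ → V²`. -/
def d1V (C : HilbertComplex W₀ W₁ W₂ W₃) : C.d1.domain →ₗ[ℝ] C.d2.domain :=
  C.d1.toFun.codRestrict C.d2.domain C.d1_mem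

/-- The compactness property in degrees `1, 2, 3`. In degree `3`, `d³ = 0` on all of `W₃`. -/
def CompactnessProperty (C : HilbertComplex W₀ W₁ W₂ W₃) : Prop :=
  CompactInclusion C.d0 C.d1 ∧ CompactInclusion C.d1 C.d2 ∧
    CompactInclusion C.d2 ((0 : W₃ →ₗ[ℝ] W₃).toPMap ⊤)

/-- The best constant valid in the Poincaré inequalities of `d¹` and `d²` (in degree `3` the
inequality is void since `d³ = 0`). -/
def poincareConst (C : HilbertComplex W₀ W₁ W₂ W₃) : ℝ :=
  sInf {c : ℝ | 0 ≤ c ∧ PoincareIneq C.d1 c ∧ PoincareIneq C.d2 c}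

/-- `𝔅² = d V¹`. -/
def B2 (C : HilbertComplex W₀ W₁ W₂ W₃) : Submodule ℝ W₂ := LinearMap.range C.d1.toFun

/-- `𝔅³ = d V²`. -/
def B3 (C : HilbertComplex W₀ W₁ W₂ W₃) : Submodule ℝ W₃ := LinearMap.range C.d2.toFun

/-- `ℌ² = ℨ² ∩ (𝔅²)ᗮ`. -/
def H2 (C : HilbertComplex W₀ W₁ W₂ W₃) : Submodule ℝ W₂ :=
  (LinearMap.ker C.d2.toFun).map C.d2.domain.subtype ⊓ C.B2ᗮ

/-- `ℌ³ = ℨ³ ∩ (𝔅³)ᗮ`, where `ℨ³ = W₃`. -/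
def H3 (C : HilbertComplex W₀ W₁ W₂ W₃) : Submodule ℝ W₃ := C.B3ᗮ

/-- The orthogonal projection `P_𝔅` in degree `2`. The closure makes the projection available for
every complex; it changes nothing when `𝔅²` is closed, as the compactness property ensures. -/
def PB2 (C : HilbertComplex W₀ W₁ W₂ W₃) (u : W₂) : W₂ :=
  C.B2.topologicalClosure.starProjection u

/-- The orthogonal projection `P_𝔅` in degree `3`. -/
def PB3 (C : HilbertComplex W₀ W₁ W₂ W₃) (u : W₃) : W₃ :=
  C.B3.topologicalClosure.starProjection u

/-- Tuples `(u₁, u₂, u₃, φ₂, φ₃) ∈ V¹ × V² × V³ × W₂ × W₃`. -/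
structure MixedTuple (C : HilbertComplex W₀ W₁ W₂ W₃) where
  u1 : C.d1.domain
  u2 : C.d2.domain
  u3 : W₃
  φ2 : W₂
  φ3 : W₃

/-- The bilinear form `B₀` with viscosity `ν`. -/
def B₀ (C : HilbertComplex W₀ W₁ W₂ W₃) (ν : ℝ) (u v : C.MixedTuple) : ℝ :=
  inner ℝ (u.u1 : W₁) (v.u1 : W₁) - inner ℝ (u.u2 : W₂) (C.d1 v.u1)
    + ν * inner ℝ (C.d1 u.u1) (v.u2 : W₂) - inner ℝ u.u3 (C.d2 v.u2) + inner ℝ u.φ2 (v.u2 : W₂)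
    + inner ℝ (C.d2 u.u2) v.u3 + inner ℝ u.φ3 v.u3
    + inner ℝ (u.u2 : W₂) v.φ2 + inner ℝ u.u3 v.φ3

/-- `u` solves the continuous mixed problem with data `(f₂, f₃)`. -/
def IsSolution (C : HilbertComplex W₀ W₁ W₂ W₃) (ν : ℝ) (f₂ : W₂) (f₃ : W₃)
    (u : C.MixedTuple) : Prop :=
  u.φ2 ∈ C.H2 ∧ u.φ3 ∈ C.H3 ∧
    ∀ v : C.MixedTuple, v.φ2 ∈ C.H2 → v.φ3 ∈ C.H3 →
      C.B₀ ν u v = inner ℝ f₂ (v.u2 : W₂) + inner ℝ f₃ v.u3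

/-- A discrete (finite dimensional) subcomplex `V¹_h → V²_h → V³_h`, together with a cochain
projection `π_h` from `V` onto it. -/
structure Discretization (C : HilbertComplex W₀ W₁ W₂ W₃) where
  V1 : Submodule ℝ C.d1.domain
  V2 : Submodule ℝ C.d2.domain
  V3 : Submodule ℝ W₃
  finite_V1 : FiniteDimensional ℝ V1
  finite_V2 : FiniteDimensional ℝ V2
  finite_V3 : FiniteDimensional ℝ V3
  d1_mem : ∀ v ∈ V1, C.d1V v ∈ V2
  d2_mem : ∀ v ∈ V2, C.d2 v ∈ V3
  π1 : C.d1.domain →ₗ[ℝ] C.d1.domain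
  π2 : C.d2.domain →ₗ[ℝ] C.d2.domain
  π3 : W₃ →ₗ[ℝ] W₃
  π1_mem : ∀ v, π1 v ∈ V1
  π2_mem : ∀ v, π2 v ∈ V2
  π3_mem : ∀ v, π3 v ∈ V3
  π1_eq : ∀ v ∈ V1, π1 v = v
  π2_eq : ∀ v ∈ V2, π2 v = v
  π3_eq : ∀ v ∈ V3, π3 v = v
  d1_π1 : ∀ v, C.d1V (π1 v) = π2 (C.d1V v)
  d2_π2 : ∀ v, C.d2 (π2 v) = π3 (C.d2 v)

namespace Discretization

variable {C : HilbertComplex W₀ W₁ W₂ W₃}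

/-- The cochain projection is bounded by `M` for the `W`-norm, in every degree. -/
def ProjBound (D : C.Discretization) (M : ℝ) : Prop :=
  (∀ v : C.d1.domain, ‖(D.π1 v : W₁)‖ ≤ M * ‖(v : W₁)‖) ∧
  (∀ v : C.d2.domain, ‖(D.π2 v : W₂)‖ ≤ M * ‖(v : W₂)‖) ∧
  (∀ v : W₃, ‖D.π3 v‖ ≤ M * ‖v‖)

/-- The discrete harmonic forms `ℌ²_h = ℨ²_h ∩ (d V¹_h)ᗮ`. -/
def H2h (D : C.Discretization) : Submodule ℝ W₂ :=
  (D.V2 ⊓ LinearMap.ker C.d2.toFun).map C.d2.domain.subtype ⊓ (D.V1.map C.d1.toFun)ᗮ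

/-- The discrete harmonic forms `ℌ³_h = V³_h ∩ (d V²_h)ᗮ`. -/
def H3h (D : C.Discretization) : Submodule ℝ W₃ :=
  D.V3 ⊓ (D.V2.map C.d2.toFun)ᗮ

/-- `u` solves the discrete mixed problem with data `(f₂, f₃)`. -/
def IsSolution (D : C.Discretization) (ν : ℝ) (f₂ : W₂) (f₃ : W₃) (u : C.MixedTuple) : Prop :=
  u.u1 ∈ D.V1 ∧ u.u2 ∈ D.V2 ∧ u.u3 ∈ D.V3 ∧ u.φ2 ∈ D.H2h ∧ u.φ3 ∈ D.H3h ∧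
    ∀ v : C.MixedTuple, v.u1 ∈ D.V1 → v.u2 ∈ D.V2 → v.u3 ∈ D.V3 → v.φ2 ∈ D.H2h →
      v.φ3 ∈ D.H3h → C.B₀ ν u v = inner ℝ f₂ (v.u2 : W₂) + inner ℝ f₃ v.u3

/-- `E(σ) = inf_{τ ∈ V²_h} ‖σ - τ‖`. -/
def E2 (D : C.Discretization) (σ : W₂) : ℝ := ⨅ τ : D.V2, ‖σ - ((τ : C.d2.domain) : W₂)‖

/-- `E(σ) = inf_{τ ∈ V³_h} ‖σ - τ‖`. -/
def E3 (D : C.Discretization) (σ : W₃) : ℝ := ⨅ τ : D.V3, ‖σ - (τ : W₃)‖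

/-- `inf_{v ∈ V¹_h} ‖u - v‖_V`. -/
def bestV1 (D : C.Discretization) (u : C.d1.domain) : ℝ :=
  ⨅ v : D.V1, vNorm C.d1 (u - (v : C.d1.domain))

/-- `inf_{v ∈ V²_h} ‖u - v‖_V`. -/
def bestV2 (D : C.Discretization) (u : C.d2.domain) : ℝ :=
  ⨅ v : D.V2, vNorm C.d2 (u - (v : C.d2.domain))

/-- `μ = max_{k ∈ {2,3}} sup {‖(I - π_h) r‖ : r ∈ ℌᵏ, ‖r‖ = 1}`; the supremum over the empty set
(that is, when `ℌᵏ = 0`) is `0`. -/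
def mu (D : C.Discretization) : ℝ :=
  max (⨆ r : {r : C.d2.domain // (r : W₂) ∈ C.H2 ∧ ‖(r : W₂)‖ = 1},
        ‖((r : C.d2.domain) : W₂) - (D.π2 r : W₂)‖)
      (⨆ r : {r : W₃ // r ∈ C.H3 ∧ ‖r‖ = 1}, ‖(r : W₃) - D.π3 r‖)

end Discretization

end HilbertComplex

/-! ### The `L²` de Rham complex of a domain of `ℝ³`, in vector proxies -/

/-- Three-dimensional Euclidean space. -/
abbrev R3 : Type := EuclideanSpace ℝ (Fin 3)

/-- Scalar `L²` fields on `Ω`. -/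
abbrev L2s (Ω : Set R3) : Type := Lp ℝ 2 (volume.restrict Ω)

/-- Vector `L²` fields on `Ω`. -/
abbrev L2v (Ω : Set R3) : Type := Lp R3 2 (volume.restrict Ω)

/-- `ψ ∈ C_c^∞(Ω; F)`. -/
def IsTestField {F : Type*} [NormedAddCommGroup F] [NormedSpace ℝ F]
    (Ω : Set R3) (ψ : R3 → F) : Prop :=
  ContDiff ℝ ∞ ψ ∧ HasCompactSupport ψ ∧ tsupport ψ ⊆ Ω

/-- The partial derivative `∂_i ψ_j`. -/
def pderiv3 (ψ : R3 → R3) (i j : Fin 3) (x : R3) : ℝ :=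
  (fderiv ℝ ψ x (EuclideanSpace.single i 1)) j

/-- The classical curl. -/
def curl3 (ψ : R3 → R3) (x : R3) : R3 :=
  !₂[pderiv3 ψ 1 2 x - pderiv3 ψ 2 1 x,
     pderiv3 ψ 2 0 x - pderiv3 ψ 0 2 x,
     pderiv3 ψ 0 1 x - pderiv3 ψ 1 0 x]

/-- The classical divergence. -/
def div3 (ψ : R3 → R3) (x : R3) : ℝ := ∑ i : Fin 3, pderiv3 ψ i i x

/-- `g` is the weak gradient of `u` in `Ω`. -/
def HasWeakGrad (Ω : Set R3) (u : L2s Ω) (g : L2v Ω) : Prop :=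
  ∀ ψ : R3 → R3, IsTestField Ω ψ →
    ∫ x in Ω, u x * div3 ψ x = - ∫ x in Ω, inner ℝ (g x) (ψ x)

/-- `w` is the weak curl of `u` in `Ω`. -/
def HasWeakCurl (Ω : Set R3) (u w : L2v Ω) : Prop :=
  ∀ ψ : R3 → R3, IsTestField Ω ψ →
    ∫ x in Ω, inner ℝ (u x) (curl3 ψ x) = ∫ x in Ω, inner ℝ (w x) (ψ x)

/-- `q` is the weak divergence of `u` in `Ω`. -/
def HasWeakDiv (Ω : Set R3) (u : L2v Ω) (q : L2s Ω) : Prop :=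
  ∀ ψ : R3 → ℝ, IsTestField Ω ψ →
    ∫ x in Ω, inner ℝ (u x) (gradient ψ x) = - ∫ x in Ω, q x * ψ x

/-- The complex is an `L²` de Rham complex of `Ω`: its differentials are the weak gradient, curl and
divergence, on domains that contain the test fields. The freedom in the choice of the domains is
the choice of the boundary conditions; for instance `H¹, H(curl), H(div)` (no essential condition)
and `H¹₀, H₀(curl), H₀(div)` (essential conditions on the whole boundary) are possible. -/
structure IsDeRham (Ω : Set R3)
    (C : HilbertComplex (L2s Ω) (L2v Ω) (L2v Ω) (L2s Ω)) : Prop where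
  grad : ∀ u : C.d0.domain, HasWeakGrad Ω u (C.d0 u)
  curl : ∀ u : C.d1.domain, HasWeakCurl Ω u (C.d1 u)
  div : ∀ u : C.d2.domain, HasWeakDiv Ω u (C.d2 u)
  test0 : ∀ (u : L2s Ω) (ψ : R3 → ℝ), IsTestField Ω ψ → u =ᵐ[volume.restrict Ω] ψ →
    u ∈ C.d0.domain
  test1 : ∀ (u : L2v Ω) (ψ : R3 → R3), IsTestField Ω ψ → u =ᵐ[volume.restrict Ω] ψ →
    u ∈ C.d1.domain
  test2 : ∀ (u : L2v Ω) (ψ : R3 → R3), IsTestField Ω ψ → u =ᵐ[volume.restrict Ω] ψ →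
    u ∈ C.d2.domain

end

section Operators

open Filter Topology

variable {E F G : Type*} [NormedAddCommGroup E] [InnerProductSpace ℝ E]
  [NormedAddCommGroup F] [InnerProductSpace ℝ F]
  [NormedAddCommGroup G] [InnerProductSpace ℝ G]

theorem norm_le_of_inner_self_le {x : E} {c : ℝ} (hc : 0 ≤ c)
    (h : inner ℝ x x ≤ c * ‖x‖) : ‖x‖ ≤ c := by
  rw [real_inner_self_eq_norm_sq] at h
  by_contra! hlt
  nlinarith [norm_nonneg x]

theorem le_mul_iInf {ι : Type*} [Nonempty ι] {a c : ℝ} {f : ι → ℝ} (hc : 0 ≤ c)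
    (h : ∀ i, a ≤ c * f i) : a ≤ c * ⨅ i, f i := by
  rw [Real.mul_iInf_of_nonneg hc]
  exact le_ciInf h

/-- Galerkin orthogonality implies quasi-optimality. -/
theorem norm_sub_le_of_orthogonal (S : Submodule ℝ E) {a b s : E} (hb : b ∈ S) (hs : s ∈ S)
    (h : ∀ w ∈ S, inner ℝ (a - b) w = 0) : ‖a - b‖ ≤ ‖a - s‖ := by
  refine norm_le_of_inner_self_le (norm_nonneg _) ?_
  have h1 : inner ℝ (a - b) (a - b) = inner ℝ (a - b) (a - s) := by
    have := h (s - b) (S.sub_mem hs hb)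
    rw [← sub_eq_zero, ← inner_sub_right, ← this]
    congr 1
    abel
  rw [h1, mul_comm]
  exact real_inner_le_norm _ _

theorem exists_mem_sub_orthogonal (S : Submodule ℝ E) [S.HasOrthogonalProjection] (x : E) :
    ∃ s ∈ S, ∀ w ∈ S, inner ℝ w (x - s) = 0 :=
  ⟨S.starProjection x, S.starProjection_apply_mem x, fun w hw => by
    rw [real_inner_comm]; exact S.starProjection_inner_eq_zero x w hw⟩

/-- If `x ∈ V` is orthogonal to `V ∩ Sᗮ`, where `S ⊆ V`, then `x ∈ S`. -/
theorem mem_of_orthogonal_inf_orthogonal (S V : Submodule ℝ E) [S.HasOrthogonalProjection]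
    (hSV : S ≤ V) {x : E} (hx : x ∈ V) (h : ∀ y ∈ V, y ∈ Sᗮ → inner ℝ x y = 0) : x ∈ S := by
  obtain ⟨s, hs, hxs⟩ := exists_mem_sub_orthogonal S x
  have h1 : inner ℝ x (x - s) = 0 :=
    h _ (V.sub_mem hx (hSV hs)) ((Submodule.mem_orthogonal _ _).2 hxs)
  have h2 : inner ℝ (x - s) (x - s) = 0 := by
    rw [inner_sub_left, h1, hxs s hs, sub_zero]
  rw [inner_self_eq_zero, sub_eq_zero] at h2
  exact h2 ▸ hs

/-- The kernel of a closed operator is closed. -/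
theorem LinearPMap.IsClosed.isClosed_ker {T : E →ₗ.[ℝ] F} (hT : T.IsClosed) :
    _root_.IsClosed
      (((LinearMap.ker T.toFun).map T.domain.subtype : Submodule ℝ E) : Set E) := by
  have : (((LinearMap.ker T.toFun).map T.domain.subtype : Submodule ℝ E) : Set E)
      = (fun x : E => (x, (0 : F))) ⁻¹' (T.graph : Set (E × F)) := by
    ext x
    simp only [SetLike.mem_coe, Submodule.mem_map, LinearMap.mem_ker, Set.mem_preimage,
      LinearPMap.mem_graph_iff]
    constructor
    · rintro ⟨y, hy, rfl⟩
      exact ⟨y, rfl, hy⟩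
    · rintro ⟨y, rfl, hy⟩
      exact ⟨y, hy, rfl⟩
  rw [this]
  exact IsClosed.preimage (by fun_prop) hT

/-- Every value of a closed operator is attained orthogonally to its kernel. -/
theorem LinearPMap.IsClosed.exists_orthogonal_ker [CompleteSpace E] {T : E →ₗ.[ℝ] F}
    (hT : T.IsClosed) (x : T.domain) :
    ∃ y : T.domain, T y = T x ∧ ∀ w : T.domain, T w = 0 → inner ℝ (w : E) (y : E) = 0 := by
  set N := (LinearMap.ker T.toFun).map T.domain.subtype with hN
  have : CompleteSpace N := hT.isClosed_ker.completeSpace_coe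
  obtain ⟨s, hs, h⟩ := exists_mem_sub_orthogonal N (x : E)
  obtain ⟨t, ht, rfl⟩ := Submodule.mem_map.1 hs
  have ht0 : T t = 0 := ht
  refine ⟨x - t, by rw [LinearPMap.map_sub, ht0, sub_zero], fun w hw => ?_⟩
  exact h w (Submodule.mem_map_of_mem (f := T.domain.subtype) (LinearMap.mem_ker.2 hw))

/-- The analogue of `LinearPMap.IsClosed.exists_orthogonal_ker` on a finite dimensional subspace. -/
theorem LinearPMap.exists_orthogonal_ker_of_finiteDimensional (T : E →ₗ.[ℝ] F)
    (V : Submodule ℝ T.domain) [FiniteDimensional ℝ V] (x : T.domain) (hx : x ∈ V) :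
    ∃ y ∈ V, T y = T x ∧ ∀ w ∈ V, T w = 0 → inner ℝ (w : E) (y : E) = 0 := by
  set N := (V ⊓ LinearMap.ker T.toFun).map T.domain.subtype with hN
  have : FiniteDimensional ℝ (V ⊓ LinearMap.ker T.toFun : Submodule ℝ T.domain) :=
    Submodule.finiteDimensional_of_le inf_le_left
  obtain ⟨s, hs, h⟩ := exists_mem_sub_orthogonal N (x : E)
  obtain ⟨t, ht, rfl⟩ := Submodule.mem_map.1 hs
  have ht0 : T t = 0 := ht.2
  refine ⟨x - t, V.sub_mem hx ht.1, by rw [LinearPMap.map_sub, ht0, sub_zero],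
    fun w hwV hw => ?_⟩
  exact h w (Submodule.mem_map_of_mem (f := T.domain.subtype) ⟨hwV, LinearMap.mem_ker.2 hw⟩)

theorem LinearPMap.IsClosed.mem_of_tendsto {T : E →ₗ.[ℝ] F} (hT : T.IsClosed)
    {z : ℕ → T.domain} {x : E} {y : F} (hx : Tendsto (fun n => (z n : E)) atTop (𝓝 x))
    (hy : Tendsto (fun n => T (z n)) atTop (𝓝 y)) :
    ∃ h : x ∈ T.domain, T ⟨x, h⟩ = y := by
  have : (x, y) ∈ (T.graph : Set (E × F)) := by
    refine _root_.IsClosed.mem_of_tendsto (b := atTop) hT (hx.prodMk_nhds hy) (.of_forall fun n => ?_)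
    exact (LinearPMap.mem_graph_iff _).2 ⟨z n, rfl, rfl⟩
  obtain ⟨w, hw, hw'⟩ := (LinearPMap.mem_graph_iff _).1 this
  simp only at hw hw'
  subst hw
  exact ⟨w.2, hw'⟩

/-- A compact inclusion `V ∩ V* ⊂ W` yields a Poincaré inequality. -/
theorem CompactInclusion.exists_poincareIneq [CompleteSpace E] [CompleteSpace F]
    {S : E →ₗ.[ℝ] F} {T : F →ₗ.[ℝ] G}
    (hS : Dense (S.domain : Set E)) (hT : T.IsClosed)
    (hmem : ∀ u : S.domain, S u ∈ T.domain) (hTS : ∀ u : S.domain, T ⟨S u, hmem u⟩ = 0)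
    (hc : CompactInclusion S T) : ∃ c : ℝ, 0 ≤ c ∧ PoincareIneq T c := by
  by_contra! hno
  have hex : ∀ n : ℕ, ∃ z : T.domain,
      (∀ w : T.domain, T w = 0 → inner ℝ (w : F) (z : F) = 0) ∧
        ‖(z : F)‖ + ‖T z‖ = 1 ∧ ‖T z‖ ≤ 1 / ((n : ℝ) + 1) := by
    intro n
    have h := hno ((n : ℝ) + 1) (by positivity)
    simp only [PoincareIneq, not_forall, not_le] at h
    obtain ⟨z, hz, hlt⟩ := h
    have hn : (0 : ℝ) < (n : ℝ) + 1 := by positivity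
    have hpos : 0 < vNorm T z := lt_of_le_of_lt (by positivity) hlt
    refine ⟨(vNorm T z)⁻¹ • z, fun w hw => ?_, ?_, ?_⟩
    · simp [inner_smul_right, hz w hw]
    · rw [LinearPMap.map_smul, Submodule.coe_smul, norm_smul, norm_smul, ← mul_add, Real.norm_eq_abs,
        abs_of_pos (inv_pos.2 hpos)]
      exact inv_mul_cancel₀ hpos.ne'
    · rw [LinearPMap.map_smul, norm_smul, Real.norm_eq_abs, abs_of_pos (inv_pos.2 hpos),
        le_div_iff₀ hn, inv_mul_eq_div, div_mul_eq_mul_div, div_le_one hpos, mul_comm]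
      exact hlt.le
  choose z hz hz1 hzn using hex
  have hadj : ∀ n, ∃ h' : (z n : F) ∈ S.adjoint.domain, S.adjoint ⟨(z n : F), h'⟩ = 0 := by
    intro n
    have h0 : ∀ x : S.domain, inner ℝ (0 : E) (x : E) = inner ℝ (z n : F) (S x) := by
      intro x
      rw [inner_zero_left, real_inner_comm]
      exact (hz n ⟨S x, hmem x⟩ (hTS x)).symm
    have h' := S.mem_adjoint_domain_of_exists (z n : F) ⟨0, h0⟩
    exact ⟨h', LinearPMap.adjoint_apply_eq hS ⟨_, h'⟩ h0⟩
  have hin : ∀ n, (z n : F) ∈ closure {w : F | ∃ (h : w ∈ T.domain) (h' : w ∈ S.adjoint.domain),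
      ‖w‖ + ‖T ⟨w, h⟩‖ + ‖S.adjoint ⟨w, h'⟩‖ ≤ 1} := by
    intro n
    obtain ⟨h', h0⟩ := hadj n
    refine subset_closure ⟨(z n).2, h', ?_⟩
    rw [h0, norm_zero, add_zero]
    exact (hz1 n).le
  obtain ⟨x, -, φ, hφ, hx⟩ := IsCompact.tendsto_subseq hc hin
  have hT0 : Tendsto (fun n => T (z n)) atTop (𝓝 0) :=
    squeeze_zero_norm hzn tendsto_one_div_add_atTop_nhds_zero_nat
  have hT0' := hT0.comp hφ.tendsto_atTop
  obtain ⟨hxT, hTx⟩ := hT.mem_of_tendsto (z := z ∘ φ) hx hT0'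
  have horth : inner ℝ x x = 0 := by
    refine tendsto_nhds_unique (f := fun n => inner ℝ x (z (φ n) : F)) (l := atTop) ?_ ?_
    · exact tendsto_const_nhds.inner hx
    · refine tendsto_const_nhds.congr fun n => ?_
      exact (hz (φ n) ⟨x, hxT⟩ hTx).symm
  have hx0 : x = 0 := inner_self_eq_zero.1 horth
  have hlim : Tendsto (fun n => ‖(z (φ n) : F)‖ + ‖T (z (φ n))‖) atTop (𝓝 (‖x‖ + ‖(0 : G)‖)) :=
    hx.norm.add hT0'.norm
  have h1 := tendsto_nhds_unique hlim (tendsto_const_nhds.congr fun n => (hz1 (φ n)).symm)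
  simp [hx0] at h1

/-- A Poincaré inequality makes the range of a closed operator closed. -/
theorem PoincareIneq.isClosed_range [CompleteSpace E] [CompleteSpace F] {T : E →ₗ.[ℝ] F} {c : ℝ}
    (hP : PoincareIneq T c) (hT : T.IsClosed) :
    _root_.IsClosed ((LinearMap.range T.toFun : Submodule ℝ F) : Set F) := by
  refine isClosed_of_closure_subset fun y hy => ?_
  obtain ⟨s, hs, hlim⟩ := mem_closure_iff_seq_limit.1 hy
  have hex : ∀ n, ∃ z : T.domain, T z = s n ∧
      ∀ w : T.domain, T w = 0 → inner ℝ (w : E) (z : E) = 0 := by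
    intro n
    obtain ⟨x, hx⟩ := LinearMap.mem_range.1 (hs n)
    obtain ⟨z, hz, hz'⟩ := hT.exists_orthogonal_ker x
    exact ⟨z, hz.trans hx, hz'⟩
  choose z hz hz' using hex
  have hle : ∀ m n, ‖(z m : E) - z n‖ ≤ |c| * ‖s m - s n‖ := by
    intro m n
    have h := hP (z m - z n) fun w hw => by
      rw [Submodule.coe_sub, inner_sub_right, hz' m w hw, hz' n w hw, sub_zero]
    rw [vNorm, LinearPMap.map_sub, hz, hz, Submodule.coe_sub] at h
    have := mul_le_mul_of_nonneg_right (le_abs_self c) (norm_nonneg (s m - s n))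
    linarith [norm_nonneg (s m - s n)]
  have hcs : CauchySeq s := hlim.cauchySeq
  have hcz : CauchySeq fun n => (z n : E) := by
    rw [Metric.cauchySeq_iff] at hcs ⊢
    intro ε hε
    obtain ⟨N, hN⟩ := hcs (ε / (|c| + 1)) (by positivity)
    refine ⟨N, fun m hm n hn => ?_⟩
    have h1 := hN m hm n hn
    rw [dist_eq_norm, lt_div_iff₀ (by positivity)] at h1
    rw [dist_eq_norm]
    nlinarith [hle m n, norm_nonneg (s m - s n)]
  obtain ⟨x, hx⟩ := cauchySeq_tendsto_of_complete hcz
  obtain ⟨hxT, hTx⟩ := hT.mem_of_tendsto (z := z) (y := y) hx (by simpa only [hz] using hlim)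
  exact ⟨⟨x, hxT⟩, hTx⟩

/-- The discrete Poincaré inequality, for a subspace that admits a bounded projection which
preserves the values of `T` on the subspace. -/
theorem PoincareIneq.discrete [CompleteSpace E] {T : E →ₗ.[ℝ] F} {c N : ℝ}
    (hP : PoincareIneq T c) (hT : T.IsClosed) (hN : 0 ≤ N) (V : Submodule ℝ T.domain)
    (p : T.domain →ₗ[ℝ] T.domain) (hpV : ∀ v, p v ∈ V)
    (hpT : ∀ v, ∀ z ∈ V, T v = T z → T (p v) = T z)
    (hpN : ∀ v : T.domain, ‖(p v : E)‖ ≤ N * ‖(v : E)‖) {z : T.domain} (hz : z ∈ V)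
    (hz' : ∀ w ∈ V, T w = 0 → inner ℝ (w : E) (z : E) = 0) :
    ‖(z : E)‖ ≤ N * c * ‖T z‖ := by
  obtain ⟨y, hy, hy'⟩ := hT.exists_orthogonal_ker z
  have h0 : inner ℝ ((z - p y : T.domain) : E) (z : E) = 0 :=
    hz' _ (V.sub_mem hz (hpV y)) (by rw [LinearPMap.map_sub, hpT y z hz hy, sub_self])
  have h1 : ‖(z : E)‖ ≤ ‖(p y : E)‖ := by
    refine norm_le_of_inner_self_le (norm_nonneg _) ?_
    rw [Submodule.coe_sub, inner_sub_left, sub_eq_zero] at h0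
    rw [h0]
    exact real_inner_le_norm _ _
  have h2 := hP y hy'
  rw [vNorm, hy] at h2
  calc ‖(z : E)‖ ≤ N * ‖(y : E)‖ := h1.trans (hpN y)
    _ ≤ N * (c * ‖T z‖) := by gcongr; linarith [norm_nonneg (T z)]
    _ = N * c * ‖T z‖ := by ring

end Operators

namespace HilbertComplex

variable {W₀ W₁ W₂ W₃ : Type*}
  [NormedAddCommGroup W₀] [InnerProductSpace ℝ W₀]
  [NormedAddCommGroup W₁] [InnerProductSpace ℝ W₁]
  [NormedAddCommGroup W₂] [InnerProductSpace ℝ W₂]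
  [NormedAddCommGroup W₃] [InnerProductSpace ℝ W₃]
  {C : HilbertComplex W₀ W₁ W₂ W₃}

/-- Under the compactness property, every number above the best constant is a Poincaré constant. -/
theorem CompactnessProperty.poincareIneq
    [CompleteSpace W₀] [CompleteSpace W₁] [CompleteSpace W₂] (hC : C.CompactnessProperty) {k : ℝ}
    (hk : C.poincareConst < k) : 0 ≤ k ∧ PoincareIneq C.d1 k ∧ PoincareIneq C.d2 k := by
  obtain ⟨c₁, hc₁, h₁⟩ := CompactInclusion.exists_poincareIneq C.dense_d0 C.closed_d1 C.d0_mem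
    C.d1_d0 hC.1
  obtain ⟨c₂, hc₂, h₂⟩ := CompactInclusion.exists_poincareIneq C.dense_d1 C.closed_d2 C.d1_mem
    C.d2_d1 hC.2.1
  have hne : {c : ℝ | 0 ≤ c ∧ PoincareIneq C.d1 c ∧ PoincareIneq C.d2 c}.Nonempty :=
    ⟨max c₁ c₂, le_max_of_le_left hc₁, fun z hz => (h₁ z hz).trans
      (mul_le_mul_of_nonneg_right (le_max_left _ _) (norm_nonneg _)), fun z hz => (h₂ z hz).trans
      (mul_le_mul_of_nonneg_right (le_max_right _ _) (norm_nonneg _))⟩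
  obtain ⟨c, ⟨hc0, hc1, hc2⟩, hck⟩ := exists_lt_of_csInf_lt hne hk
  exact ⟨hc0.trans hck.le, fun z hz => (hc1 z hz).trans
      (mul_le_mul_of_nonneg_right hck.le (norm_nonneg _)), fun z hz => (hc2 z hz).trans
      (mul_le_mul_of_nonneg_right hck.le (norm_nonneg _))⟩

theorem d1_mem_B2 (v : C.d1.domain) : C.d1 v ∈ C.B2 := ⟨v, rfl⟩

theorem d2_mem_B3 (v : C.d2.domain) : C.d2 v ∈ C.B3 := ⟨v, rfl⟩

theorem mem_H2_iff {x : W₂} :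
    x ∈ C.H2 ↔ (∃ h : x ∈ C.d2.domain, C.d2 ⟨x, h⟩ = 0) ∧
      ∀ v : C.d1.domain, inner ℝ (C.d1 v) x = 0 := by
  rw [H2, Submodule.mem_inf, Submodule.mem_map, Submodule.mem_orthogonal]
  refine and_congr ⟨?_, ?_⟩ ⟨fun h v => h _ (d1_mem_B2 v), ?_⟩
  · rintro ⟨y, hy, rfl⟩
    exact ⟨y.2, hy⟩
  · rintro ⟨h, h0⟩
    exact ⟨⟨x, h⟩, h0, rfl⟩
  · rintro h _ ⟨v, rfl⟩
    exact h v

theorem mem_H3_iff {x : W₃} : x ∈ C.H3 ↔ ∀ v : C.d2.domain, inner ℝ (C.d2 v) x = 0 := by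
  rw [H3, Submodule.mem_orthogonal]
  refine ⟨fun h v => h _ (d2_mem_B3 v), ?_⟩
  rintro h _ ⟨v, rfl⟩
  exact h v

/-! ### The equations of the continuous problem -/

namespace IsSolution

variable {ν : ℝ} {f₂ : W₂} {f₃ : W₃} {u : C.MixedTuple}

theorem inner_u1 (h : C.IsSolution ν f₂ f₃ u) (v : C.d1.domain) :
    inner ℝ (u.u1 : W₁) (v : W₁) = inner ℝ (u.u2 : W₂) (C.d1 v) := by
  have := h.2.2 ⟨v, 0, 0, 0, 0⟩ C.H2.zero_mem C.H3.zero_mem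
  simp [B₀] at this
  linarith

theorem inner_u2 (h : C.IsSolution ν f₂ f₃ u) (v : C.d2.domain) :
    ν * inner ℝ (C.d1 u.u1) (v : W₂) - inner ℝ u.u3 (C.d2 v) + inner ℝ u.φ2 (v : W₂)
      = inner ℝ f₂ (v : W₂) := by
  have := h.2.2 ⟨0, v, 0, 0, 0⟩ C.H2.zero_mem C.H3.zero_mem
  simp [B₀] at this
  linarith

theorem inner_u3 (h : C.IsSolution ν f₂ f₃ u) (v : W₃) :
    inner ℝ (C.d2 u.u2) v + inner ℝ u.φ3 v = inner ℝ f₃ v := by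
  have := h.2.2 ⟨0, 0, v, 0, 0⟩ C.H2.zero_mem C.H3.zero_mem
  simp [B₀] at this
  linarith

theorem inner_φ2 (h : C.IsSolution ν f₂ f₃ u) {χ : W₂} (hχ : χ ∈ C.H2) :
    inner ℝ (u.u2 : W₂) χ = 0 := by
  have := h.2.2 ⟨0, 0, 0, χ, 0⟩ hχ C.H3.zero_mem
  simpa [B₀] using this

theorem inner_φ3 (h : C.IsSolution ν f₂ f₃ u) {χ : W₃} (hχ : χ ∈ C.H3) :
    inner ℝ u.u3 χ = 0 := by
  have := h.2.2 ⟨0, 0, 0, 0, χ⟩ C.H2.zero_mem hχ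
  simpa [B₀] using this

end IsSolution

namespace Discretization

variable {D : C.Discretization}

theorem mem_H2h_iff {x : W₂} :
    x ∈ D.H2h ↔ (∃ h : x ∈ C.d2.domain, (⟨x, h⟩ : C.d2.domain) ∈ D.V2 ∧ C.d2 ⟨x, h⟩ = 0) ∧
      ∀ v ∈ D.V1, inner ℝ (C.d1 v) x = 0 := by
  rw [H2h, Submodule.mem_inf, Submodule.mem_map, Submodule.mem_orthogonal]
  refine and_congr ⟨?_, ?_⟩ ⟨fun h v hv => h _ ⟨v, hv, rfl⟩, ?_⟩
  · rintro ⟨y, hy, rfl⟩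
    exact ⟨y.2, hy⟩
  · rintro ⟨h, h0⟩
    exact ⟨⟨x, h⟩, h0, rfl⟩
  · rintro h _ ⟨v, hv, rfl⟩
    exact h v hv

theorem mem_H3h_iff {x : W₃} :
    x ∈ D.H3h ↔ x ∈ D.V3 ∧ ∀ v ∈ D.V2, inner ℝ (C.d2 v) x = 0 := by
  rw [H3h, Submodule.mem_inf, Submodule.mem_orthogonal]
  refine and_congr Iff.rfl ⟨fun h v hv => h _ ⟨v, hv, rfl⟩, ?_⟩
  rintro h _ ⟨v, hv, rfl⟩
  exact h v hv

/-! ### The equations of the discrete problem -/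

namespace IsSolution

variable {ν : ℝ} {f₂ : W₂} {f₃ : W₃} {u : C.MixedTuple}

theorem inner_u1 (h : D.IsSolution ν f₂ f₃ u) {v : C.d1.domain} (hv : v ∈ D.V1) :
    inner ℝ (u.u1 : W₁) (v : W₁) = inner ℝ (u.u2 : W₂) (C.d1 v) := by
  have := h.2.2.2.2.2 ⟨v, 0, 0, 0, 0⟩ hv D.V2.zero_mem D.V3.zero_mem D.H2h.zero_mem D.H3h.zero_mem
  simp [B₀] at this
  linarith

theorem inner_u2 (h : D.IsSolution ν f₂ f₃ u) {v : C.d2.domain} (hv : v ∈ D.V2) :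
    ν * inner ℝ (C.d1 u.u1) (v : W₂) - inner ℝ u.u3 (C.d2 v) + inner ℝ u.φ2 (v : W₂)
      = inner ℝ f₂ (v : W₂) := by
  have := h.2.2.2.2.2 ⟨0, v, 0, 0, 0⟩ D.V1.zero_mem hv D.V3.zero_mem D.H2h.zero_mem D.H3h.zero_mem
  simp [B₀] at this
  linarith

theorem inner_u3 (h : D.IsSolution ν f₂ f₃ u) {v : W₃} (hv : v ∈ D.V3) :
    inner ℝ (C.d2 u.u2) v + inner ℝ u.φ3 v = inner ℝ f₃ v := by
  have := h.2.2.2.2.2 ⟨0, 0, v, 0, 0⟩ D.V1.zero_mem D.V2.zero_mem hv D.H2h.zero_mem D.H3h.zero_mem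
  simp [B₀] at this
  linarith

theorem inner_φ2 (h : D.IsSolution ν f₂ f₃ u) {χ : W₂} (hχ : χ ∈ D.H2h) :
    inner ℝ (u.u2 : W₂) χ = 0 := by
  have := h.2.2.2.2.2 ⟨0, 0, 0, χ, 0⟩ D.V1.zero_mem D.V2.zero_mem D.V3.zero_mem hχ D.H3h.zero_mem
  simpa [B₀] using this

theorem inner_φ3 (h : D.IsSolution ν f₂ f₃ u) {χ : W₃} (hχ : χ ∈ D.H3h) :
    inner ℝ u.u3 χ = 0 := by
  have := h.2.2.2.2.2 ⟨0, 0, 0, 0, χ⟩ D.V1.zero_mem D.V2.zero_mem D.V3.zero_mem D.H2h.zero_mem hχ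
  simpa [B₀] using this

/-- The discrete third component is exact. -/
theorem exists_u3_eq (h : D.IsSolution ν f₂ f₃ u) : ∃ v ∈ D.V2, C.d2 v = u.u3 := by
  have := D.finite_V2
  have hmem : u.u3 ∈ D.V2.map C.d2.toFun := by
    refine mem_of_orthogonal_inf_orthogonal _ D.V3 ?_ h.2.2.1 fun y hy hy' => ?_
    · rintro _ ⟨v, hv, rfl⟩
      exact D.d2_mem v hv
    · exact h.inner_φ3 ⟨hy, hy'⟩
  obtain ⟨v, hv, hv'⟩ := hmem
  exact ⟨v, hv, hv'⟩

end IsSolution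

/-! ### Consequences of the boundedness of the projections -/

section Projection

variable {N : ℝ}

theorem ProjBound.norm_sub_π1_le (hD : D.ProjBound N) {v : C.d1.domain} (hv : v ∈ D.V1)
    (u : C.d1.domain) :
    ‖((u - D.π1 u : C.d1.domain) : W₁)‖ ≤ (1 + N) * ‖((u - v : C.d1.domain) : W₁)‖ := by
  have : u - D.π1 u = (u - v) - D.π1 (u - v) := by rw [map_sub, D.π1_eq v hv]; abel
  rw [this, Submodule.coe_sub, one_add_mul]
  exact (norm_sub_le _ _).trans (add_le_add le_rfl (hD.1 _))

theorem ProjBound.norm_sub_π2_le (hD : D.ProjBound N) {v : C.d2.domain} (hv : v ∈ D.V2)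
    (u : C.d2.domain) :
    ‖((u - D.π2 u : C.d2.domain) : W₂)‖ ≤ (1 + N) * ‖((u - v : C.d2.domain) : W₂)‖ := by
  have : u - D.π2 u = (u - v) - D.π2 (u - v) := by rw [map_sub, D.π2_eq v hv]; abel
  rw [this, Submodule.coe_sub, one_add_mul]
  exact (norm_sub_le _ _).trans (add_le_add le_rfl (hD.2.1 _))

theorem ProjBound.norm_sub_π3_le (hD : D.ProjBound N) {v : W₃} (hv : v ∈ D.V3)
    (u : W₃) : ‖u - D.π3 u‖ ≤ (1 + N) * ‖u - v‖ := by
  have : u - D.π3 u = (u - v) - D.π3 (u - v) := by rw [map_sub, D.π3_eq v hv]; abel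
  rw [this, one_add_mul]
  exact (norm_sub_le _ _).trans (add_le_add le_rfl (hD.2.2 _))

theorem d1_π1_coe (u : C.d1.domain) : C.d1 (D.π1 u) = (D.π2 (C.d1V u) : W₂) :=
  congrArg Subtype.val (D.d1_π1 u)

theorem ProjBound.vNorm_sub_π1_le (hD : D.ProjBound N) (hN : 0 ≤ N) (u : C.d1.domain) :
    vNorm C.d1 (u - D.π1 u) ≤ (1 + N) * D.bestV1 u := by
  refine le_mul_iInf (by positivity) fun v => ?_
  have h := hD.norm_sub_π2_le (D.d1_mem v v.2) (C.d1V u)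
  rw [vNorm, vNorm, mul_add, LinearPMap.map_sub, LinearPMap.map_sub, d1_π1_coe]
  exact add_le_add (hD.norm_sub_π1_le v.2 u) h

theorem ProjBound.vNorm_sub_π2_le (hD : D.ProjBound N) (hN : 0 ≤ N) (u : C.d2.domain) :
    vNorm C.d2 (u - D.π2 u) ≤ (1 + N) * D.bestV2 u := by
  refine le_mul_iInf (by positivity) fun v => ?_
  rw [vNorm, vNorm, mul_add, LinearPMap.map_sub, LinearPMap.map_sub, D.d2_π2]
  exact add_le_add (hD.norm_sub_π2_le v.2 u) (hD.norm_sub_π3_le (D.d2_mem v v.2) _)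

theorem ProjBound.norm_sub_π2_le_E2 (hD : D.ProjBound N) (hN : 0 ≤ N) (u : C.d2.domain) :
    ‖(u : W₂) - D.π2 u‖ ≤ (1 + N) * D.E2 u :=
  le_mul_iInf (by positivity) fun v => hD.norm_sub_π2_le v.2 u

theorem ProjBound.norm_sub_π3_le_E3 (hD : D.ProjBound N) (hN : 0 ≤ N) (u : W₃) :
    ‖u - D.π3 u‖ ≤ (1 + N) * D.E3 u :=
  le_mul_iInf (by positivity) fun v => hD.norm_sub_π3_le v.2 u

theorem mu_nonneg : 0 ≤ D.mu :=
  le_max_of_le_left (Real.iSup_nonneg fun _ => norm_nonneg _)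

theorem ProjBound.norm_sub_π2_le_mu (hD : D.ProjBound N) {r : C.d2.domain}
    (hr : (r : W₂) ∈ C.H2) : ‖(r : W₂) - D.π2 r‖ ≤ D.mu * ‖(r : W₂)‖ := by
  rcases eq_or_ne r 0 with rfl | hr0
  · simp
  have hpos : 0 < ‖(r : W₂)‖ := norm_pos_iff.2 fun h => hr0 (Subtype.ext h)
  set s : C.d2.domain := ‖(r : W₂)‖⁻¹ • r with hs
  have hs1 : ‖(s : W₂)‖ = 1 := by
    rw [hs, Submodule.coe_smul, norm_smul, norm_inv, norm_norm, inv_mul_cancel₀ hpos.ne']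
  have hsH : (s : W₂) ∈ C.H2 := C.H2.smul_mem _ hr
  have hbdd : BddAbove (Set.range fun r : {r : C.d2.domain // (r : W₂) ∈ C.H2 ∧ ‖(r : W₂)‖ = 1} =>
      ‖((r : C.d2.domain) : W₂) - (D.π2 r : W₂)‖) := by
    refine ⟨1 + N, ?_⟩
    rintro _ ⟨t, rfl⟩
    have := hD.norm_sub_π2_le D.V2.zero_mem (t : C.d2.domain)
    rw [sub_zero, t.2.2, mul_one] at this
    exact this
  have hle : ‖(s : W₂) - D.π2 s‖ ≤ D.mu := (le_ciSup hbdd ⟨s, hsH, hs1⟩).trans (le_max_left _ _)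
  have hrs : (r : W₂) - D.π2 r = ‖(r : W₂)‖ • ((s : W₂) - D.π2 s) := by
    rw [hs, map_smul, Submodule.coe_smul, Submodule.coe_smul, ← smul_sub, smul_smul,
      mul_inv_cancel₀ hpos.ne', one_smul]
  rw [hrs, norm_smul, norm_norm, mul_comm]
  gcongr

theorem ProjBound.mono (hD : D.ProjBound N) {N' : ℝ} (h : N ≤ N') : D.ProjBound N' :=
  ⟨fun v => (hD.1 v).trans (by gcongr), fun v => (hD.2.1 v).trans (by gcongr),
    fun v => (hD.2.2 v).trans (by gcongr)⟩

theorem ProjBound.poincare_d1 [CompleteSpace W₁] (hD : D.ProjBound N) (hN : 0 ≤ N) {k : ℝ}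
    (hk : PoincareIneq C.d1 k) {z : C.d1.domain} (hz : z ∈ D.V1)
    (hz' : ∀ w ∈ D.V1, C.d1 w = 0 → inner ℝ (w : W₁) (z : W₁) = 0) :
    ‖(z : W₁)‖ ≤ N * k * ‖C.d1 z‖ := by
  refine hk.discrete C.closed_d1 hN D.V1 D.π1 D.π1_mem (fun v z hz h => ?_) hD.1 hz hz'
  have h' : C.d1V v = C.d1V z := Subtype.ext h
  rw [d1_π1_coe, h', ← d1_π1_coe, D.π1_eq z hz]

theorem ProjBound.poincare_d2 [CompleteSpace W₂] (hD : D.ProjBound N) (hN : 0 ≤ N) {k : ℝ}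
    (hk : PoincareIneq C.d2 k) {z : C.d2.domain} (hz : z ∈ D.V2)
    (hz' : ∀ w ∈ D.V2, C.d2 w = 0 → inner ℝ (w : W₂) (z : W₂) = 0) :
    ‖(z : W₂)‖ ≤ N * k * ‖C.d2 z‖ := by
  refine hk.discrete C.closed_d2 hN D.V2 D.π2 D.π2_mem (fun v z hz h => ?_) hD.2.1 hz hz'
  rw [D.d2_π2, h, ← D.d2_π2, D.π2_eq z hz]

end Projection

end Discretization

end HilbertComplex

namespace HilbertComplex

variable {W₀ W₁ W₂ W₃ : Type*}
  [NormedAddCommGroup W₀] [InnerProductSpace ℝ W₀]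
  [NormedAddCommGroup W₁] [InnerProductSpace ℝ W₁]
  [NormedAddCommGroup W₂] [InnerProductSpace ℝ W₂]
  [NormedAddCommGroup W₃] [InnerProductSpace ℝ W₃]
  {C : HilbertComplex W₀ W₁ W₂ W₃} {D : C.Discretization}
  {ν : ℝ} {f₂ : W₂} {f₃ : W₃} {u uh : C.MixedTuple}

theorem inner_d1_eq_zero_of_mem_H2 {x : W₂} (hx : x ∈ C.H2) (v : C.d1.domain) :
    inner ℝ x (C.d1 v) = 0 := by
  rw [real_inner_comm]; exact (mem_H2_iff.1 hx).2 v

theorem inner_d2_eq_zero_of_mem_H3 {x : W₃} (hx : x ∈ C.H3) (v : C.d2.domain) :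
    inner ℝ x (C.d2 v) = 0 := by
  rw [real_inner_comm]; exact mem_H3_iff.1 hx v

/-- The third component of the continuous solution is exact. -/
theorem IsSolution.exists_u3_eq [CompleteSpace W₃] (hu : C.IsSolution ν f₂ f₃ u)
    (hB : IsClosed (C.B3 : Set W₃)) : ∃ w : C.d2.domain, C.d2 w = u.u3 := by
  have : CompleteSpace C.B3 := hB.completeSpace_coe
  exact mem_of_orthogonal_inf_orthogonal C.B3 ⊤ le_top Submodule.mem_top
    fun y _ hy => hu.inner_φ3 hy

/-- The Hodge decomposition of the second component of the continuous solution. -/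
theorem IsSolution.hodge_u2 [CompleteSpace W₂] (hu : C.IsSolution ν f₂ f₃ u)
    (hB : IsClosed (C.B2 : Set W₂)) :
    (∃ w : C.d1.domain, C.d1 w = C.PB2 u.u2) ∧
      ∀ r : C.d2.domain, C.d2 r = 0 → inner ℝ (u.u2 : W₂) (r : W₂) = inner ℝ (C.PB2 u.u2) (r : W₂)
      := by
  have hcl : C.B2.topologicalClosure = C.B2 := hB.submodule_topologicalClosure_eq
  have hmem : ∀ x : W₂, ∃ w : C.d1.domain, C.d1 w = C.PB2 x := fun x => by
    exact hcl.le (C.B2.topologicalClosure.starProjection_apply_mem x)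
  have horth : ∀ x y : W₂, y ∈ C.B2 → inner ℝ (x - C.PB2 x) y = 0 := fun x y hy =>
    C.B2.topologicalClosure.starProjection_inner_eq_zero x y (C.B2.le_topologicalClosure hy)
  refine ⟨hmem _, fun r hr => ?_⟩
  obtain ⟨w, hw⟩ := hmem u.u2
  obtain ⟨b, hb⟩ := hmem r
  have hrH : (r : W₂) - C.PB2 r ∈ C.H2 := by
    have hd : C.d2 (r - C.d1V b) = 0 := by
      have : C.d2 (C.d1V b) = 0 := C.d2_d1 b
      rw [LinearPMap.map_sub, hr, this, sub_self]
    have hs : ((r - C.d1V b : C.d2.domain) : W₂) = (r : W₂) - C.PB2 r := by rw [← hb]; rfl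
    rw [← hs]
    refine mem_H2_iff.2 ⟨⟨(r - C.d1V b).2, hd⟩, fun v => ?_⟩
    rw [hs, real_inner_comm]
    exact horth _ _ (d1_mem_B2 v)
  have h1 := hu.inner_φ2 hrH
  have h2 := inner_d1_eq_zero_of_mem_H2 hrH w
  have h3 := horth u.u2 (C.PB2 r) ⟨b, hb⟩
  rw [hw, real_inner_comm] at h2
  rw [inner_sub_right] at h1 h2
  rw [inner_sub_left] at h3
  linarith

namespace Discretization

/-! ### Error estimates -/

theorem IsSolution.norm_d2_u2_error (hu : C.IsSolution ν f₂ f₃ u) (hh : D.IsSolution ν f₂ f₃ uh)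
    {v : C.d2.domain} (hv : v ∈ D.V2) :
    ‖C.d2 (u.u2 - uh.u2)‖ ≤ ‖C.d2 (u.u2 - v)‖ := by
  rw [LinearPMap.map_sub, LinearPMap.map_sub]
  refine norm_sub_le_of_orthogonal (D.V2.map C.d2.toFun) ⟨uh.u2, hh.2.1, rfl⟩ ⟨v, hv, rfl⟩ ?_
  rintro _ ⟨w, hw, rfl⟩
  change inner ℝ _ (C.d2 w) = 0
  have h1 := hu.inner_u3 (C.d2 w)
  have h2 := hh.inner_u3 (D.d2_mem w hw)
  rw [inner_d2_eq_zero_of_mem_H3 hu.2.1 w] at h1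
  rw [real_inner_comm _ uh.φ3, (mem_H3h_iff.1 hh.2.2.2.2.1).2 w hw] at h2
  rw [inner_sub_left]
  linarith

theorem IsSolution.norm_d1_u1_error (hν : 0 < ν) (hu : C.IsSolution ν f₂ f₃ u)
    (hh : D.IsSolution ν f₂ f₃ uh) {v : C.d1.domain} (hv : v ∈ D.V1) :
    ‖C.d1 (u.u1 - uh.u1)‖ ≤ ‖C.d1 (u.u1 - v)‖ := by
  rw [LinearPMap.map_sub, LinearPMap.map_sub]
  refine norm_sub_le_of_orthogonal (D.V1.map C.d1.toFun) ⟨uh.u1, hh.1, rfl⟩ ⟨v, hv, rfl⟩ ?_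
  rintro _ ⟨w, hw, rfl⟩
  change inner ℝ _ (C.d1 w) = 0
  have h1 := hu.inner_u2 (C.d1V w)
  have h2 := hh.inner_u2 (D.d1_mem w hw)
  have h0 : C.d2 (C.d1V w) = 0 := C.d2_d1 w
  have hw' : ((C.d1V w : C.d2.domain) : W₂) = C.d1 w := rfl
  rw [h0, inner_zero_right, hw'] at h1 h2
  rw [inner_d1_eq_zero_of_mem_H2 hu.1 w] at h1
  rw [real_inner_comm _ uh.φ2, (mem_H2h_iff.1 hh.2.2.2.1).2 w hw] at h2
  rw [inner_sub_left]
  have : ν * (inner ℝ (C.d1 u.u1) (C.d1 w) - inner ℝ (C.d1 uh.u1) (C.d1 w)) = 0 := by linarith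
  exact (mul_eq_zero.1 this).resolve_left hν.ne'

theorem IsSolution.norm_φ3_error (hu : C.IsSolution ν f₂ f₃ u) (hh : D.IsSolution ν f₂ f₃ uh)
    {v : C.d2.domain} (hv : v ∈ D.V2) {w : W₃} (hw : w ∈ D.V3) :
    ‖u.φ3 - uh.φ3‖ ≤ ‖u.φ3 - w‖ + 2 * ‖C.d2 (u.u2 - v)‖ := by
  have h0 := norm_d2_u2_error hu hh hv
  have h1 : ‖(u.φ3 + C.d2 u.u2) - (uh.φ3 + C.d2 uh.u2)‖ ≤ ‖(u.φ3 + C.d2 u.u2) - (w + C.d2 v)‖ := by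
    refine norm_sub_le_of_orthogonal D.V3
      (D.V3.add_mem (mem_H3h_iff.1 hh.2.2.2.2.1).1 (D.d2_mem _ hh.2.1))
      (D.V3.add_mem hw (D.d2_mem _ hv)) fun x hx => ?_
    have h1 := hu.inner_u3 x
    have h2 := hh.inner_u3 hx
    rw [inner_sub_left, inner_add_left, inner_add_left]
    linarith
  rw [LinearPMap.map_sub] at h0 ⊢
  rw [LinearPMap.map_sub] at h0
  have h2 : ‖u.φ3 - uh.φ3‖ ≤ ‖(u.φ3 + C.d2 u.u2) - (uh.φ3 + C.d2 uh.u2)‖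
      + ‖C.d2 u.u2 - C.d2 uh.u2‖ := by
    refine le_trans (le_of_eq ?_) (norm_sub_le _ _)
    congr 1; abel
  have h3 : ‖(u.φ3 + C.d2 u.u2) - (w + C.d2 v)‖ ≤ ‖u.φ3 - w‖ + ‖C.d2 u.u2 - C.d2 v‖ := by
    rw [add_sub_add_comm]; exact norm_add_le _ _
  linarith

theorem IsSolution.norm_φ2_error (hν : 0 < ν) (hu : C.IsSolution ν f₂ f₃ u)
    (hh : D.IsSolution ν f₂ f₃ uh) {v : C.d1.domain} (hv : v ∈ D.V1) {z : C.d2.domain}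
    (hz : z ∈ D.V2) (hz0 : C.d2 z = 0) :
    ‖u.φ2 - uh.φ2‖ ≤ ‖u.φ2 - z‖ + 2 * (ν * ‖C.d1 (u.u1 - v)‖) := by
  have h0 := mul_le_mul_of_nonneg_left (norm_d1_u1_error hν hu hh hv) hν.le
  have hd1 : ∀ w ∈ D.V1, C.d1 w ∈ (D.V2 ⊓ LinearMap.ker C.d2.toFun).map C.d2.domain.subtype :=
    fun w hw => ⟨C.d1V w, ⟨D.d1_mem w hw, C.d2_d1 w⟩, rfl⟩
  have h1 : ‖(u.φ2 + ν • C.d1 u.u1) - (uh.φ2 + ν • C.d1 uh.u1)‖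
      ≤ ‖(u.φ2 + ν • C.d1 u.u1) - (z + ν • C.d1 v)‖ := by
    refine norm_sub_le_of_orthogonal ((D.V2 ⊓ LinearMap.ker C.d2.toFun).map C.d2.domain.subtype)
      (Submodule.add_mem _ hh.2.2.2.1.1 (Submodule.smul_mem _ _ (hd1 _ hh.1)))
      (Submodule.add_mem _ ⟨z, ⟨hz, hz0⟩, rfl⟩ (Submodule.smul_mem _ _ (hd1 _ hv))) ?_
    rintro _ ⟨x, ⟨hx, hx0⟩, rfl⟩
    have hx0' : C.d2 x = 0 := hx0
    have h1 := hu.inner_u2 x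
    have h2 := hh.inner_u2 hx
    rw [hx0', inner_zero_right] at h1 h2
    rw [Submodule.subtype_apply, inner_sub_left, inner_add_left, inner_add_left,
      real_inner_smul_left, real_inner_smul_left]
    linarith
  rw [LinearPMap.map_sub, LinearPMap.map_sub] at h0
  rw [LinearPMap.map_sub]
  have hs : ∀ a b : W₂, ‖ν • a - ν • b‖ = ν * ‖a - b‖ := fun a b => by
    rw [← smul_sub, norm_smul, Real.norm_of_nonneg hν.le]
  have h2 : ‖u.φ2 - uh.φ2‖ ≤ ‖(u.φ2 + ν • C.d1 u.u1) - (uh.φ2 + ν • C.d1 uh.u1)‖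
      + ‖ν • C.d1 u.u1 - ν • C.d1 uh.u1‖ := by
    refine le_trans (le_of_eq ?_) (norm_sub_le _ _)
    congr 1; abel
  have h3 : ‖(u.φ2 + ν • C.d1 u.u1) - (z + ν • C.d1 v)‖
      ≤ ‖u.φ2 - z‖ + ‖ν • C.d1 u.u1 - ν • C.d1 v‖ := by
    rw [add_sub_add_comm]; exact norm_add_le _ _
  rw [hs] at h2 h3
  linarith

/-- The discrete Poincaré inequality in degree `1`. -/
def DiscretePoincare1 (D : C.Discretization) (c : ℝ) : Prop :=
  ∀ z ∈ D.V1, (∀ w ∈ D.V1, C.d1 w = 0 → inner ℝ (w : W₁) (z : W₁) = 0) →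
    ‖(z : W₁)‖ ≤ c * ‖C.d1 z‖

/-- The discrete Poincaré inequality in degree `2`. -/
def DiscretePoincare2 (D : C.Discretization) (c : ℝ) : Prop :=
  ∀ z ∈ D.V2, (∀ w ∈ D.V2, C.d2 w = 0 → inner ℝ (w : W₂) (z : W₂) = 0) →
    ‖(z : W₂)‖ ≤ c * ‖C.d2 z‖

theorem IsSolution.norm_u1_error {c : ℝ} (hc : 0 ≤ c) (hP : D.DiscretePoincare1 c) (hν : 0 < ν)
    (hu : C.IsSolution ν f₂ f₃ u) (hh : D.IsSolution ν f₂ f₃ uh) {v : C.d1.domain}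
    (hv : v ∈ D.V1) :
    ‖((u.u1 - uh.u1 : C.d1.domain) : W₁)‖
      ≤ 2 * ‖((u.u1 - v : C.d1.domain) : W₁)‖ + 2 * c * ‖C.d1 (u.u1 - v)‖ := by
  have := D.finite_V1
  obtain ⟨y, hy, hdy, hy'⟩ :=
    C.d1.exists_orthogonal_ker_of_finiteDimensional D.V1 (uh.u1 - v) (D.V1.sub_mem hh.1 hv)
  set z := (uh.u1 - v) - y with hz
  have hzV : z ∈ D.V1 := D.V1.sub_mem (D.V1.sub_mem hh.1 hv) hy
  have hz0 : C.d1 z = 0 := by rw [hz, LinearPMap.map_sub, hdy, sub_self]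
  have hyn : ‖(y : W₁)‖ ≤ c * (2 * ‖C.d1 (u.u1 - v)‖) := by
    refine (hP y hy hy').trans (mul_le_mul_of_nonneg_left ?_ hc)
    rw [hdy]
    have : uh.u1 - v = (u.u1 - v) - (u.u1 - uh.u1) := by abel
    rw [this, LinearPMap.map_sub]
    have h1 := norm_d1_u1_error hν hu hh hv
    exact (norm_sub_le _ _).trans (by linarith)
  have hzn : ‖(z : W₁)‖ ≤ ‖((u.u1 - v : C.d1.domain) : W₁)‖ := by
    refine norm_le_of_inner_self_le (norm_nonneg _) ?_
    have h1 := hu.inner_u1 z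
    have h2 := hh.inner_u1 hzV
    have h3 := hy' z hzV hz0
    rw [hz0, inner_zero_right] at h1 h2
    have h4 : inner ℝ (z : W₁) (z : W₁) = inner ℝ ((u.u1 - v : C.d1.domain) : W₁) (z : W₁) := by
      nth_rw 1 [hz]
      rw [real_inner_comm] at h3
      simp only [Submodule.coe_sub, inner_sub_left]
      linarith
    rw [h4]
    exact real_inner_le_norm _ _
  have hsplit : ((u.u1 - uh.u1 : C.d1.domain) : W₁)
      = ((u.u1 - v : C.d1.domain) : W₁) - ((y : W₁) + (z : W₁)) := by
    rw [hz]; simp only [Submodule.coe_sub]; abel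
  rw [hsplit]
  have h5 := norm_sub_le ((u.u1 - v : C.d1.domain) : W₁) ((y : W₁) + (z : W₁))
  have h6 := norm_add_le (y : W₁) (z : W₁)
  linarith

theorem IsSolution.norm_u3_error {c : ℝ} (hc : 0 ≤ c) (hP : D.DiscretePoincare2 c) (hν : 0 < ν)
    (hu : C.IsSolution ν f₂ f₃ u) (hh : D.IsSolution ν f₂ f₃ uh) {w : C.d2.domain}
    (hw : w ∈ D.V2) :
    ‖u.u3 - uh.u3‖ ≤ 2 * ‖u.u3 - C.d2 w‖
      + c * (ν * ‖C.d1 (u.u1 - uh.u1)‖ + ‖u.φ2 - uh.φ2‖) := by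
  have := D.finite_V2
  obtain ⟨w', hw', hwu⟩ := hh.exists_u3_eq
  obtain ⟨y, hy, hdy, hy'⟩ :=
    C.d2.exists_orthogonal_ker_of_finiteDimensional D.V2 (w' - w) (D.V2.sub_mem hw' hw)
  have hyn := hP y hy hy'
  rw [LinearPMap.map_sub, hwu] at hdy
  have h1 : ‖C.d2 y‖ ≤ ‖u.u3 - C.d2 w‖
      + c * (ν * ‖C.d1 (u.u1 - uh.u1)‖ + ‖u.φ2 - uh.φ2‖) := by
    refine norm_le_of_inner_self_le (by positivity) ?_
    have e1 := hu.inner_u2 y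
    have e2 := hh.inner_u2 hy
    have e3 : inner ℝ (C.d2 y) (C.d2 y) = inner ℝ (u.u3 - C.d2 w) (C.d2 y)
        - ν * inner ℝ (C.d1 (u.u1 - uh.u1)) (y : W₂) - inner ℝ (u.φ2 - uh.φ2) (y : W₂) := by
      nth_rw 1 [hdy]
      rw [LinearPMap.map_sub]
      simp only [inner_sub_left]
      linarith
    have i1 := real_inner_le_norm (u.u3 - C.d2 w) (C.d2 y)
    have i2 := (neg_le_abs _).trans (abs_real_inner_le_norm (C.d1 (u.u1 - uh.u1)) (y : W₂))
    have i3 := (neg_le_abs _).trans (abs_real_inner_le_norm (u.φ2 - uh.φ2) (y : W₂))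
    have i4 := mul_le_mul_of_nonneg_left i2 hν.le
    have i5 := mul_le_mul_of_nonneg_left hyn
      (show 0 ≤ ν * ‖C.d1 (u.u1 - uh.u1)‖ + ‖u.φ2 - uh.φ2‖ by positivity)
    rw [e3]
    linarith
  have h2 : u.u3 - uh.u3 = (u.u3 - C.d2 w) - C.d2 y := by rw [hdy]; abel
  rw [h2]
  have h3 := norm_sub_le (u.u3 - C.d2 w) (C.d2 y)
  linarith

/-- Exact fields are nearly orthogonal to discrete harmonic fields. -/
theorem ProjBound.abs_inner_d1_le [CompleteSpace W₂] {N : ℝ} (hD : D.ProjBound N)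
    (hB : IsClosed (C.B2 : Set W₂)) (a : C.d1.domain) {r : W₂} (hr : r ∈ D.H2h) :
    |inner ℝ (C.d1 a) r| ≤ ‖C.d1 a - C.d1 (D.π1 a)‖ * (D.mu * ‖r‖) := by
  have : CompleteSpace C.B2 := hB.completeSpace_coe
  obtain ⟨⟨hrd, hrV, hr0⟩, hrB⟩ := mem_H2h_iff.1 hr
  obtain ⟨_, ⟨b, rfl⟩, hb⟩ := exists_mem_sub_orthogonal C.B2 r
  change ∀ w ∈ C.B2, inner ℝ w (r - C.d1 b) = 0 at hb
  set s : C.d2.domain := ⟨r, hrd⟩ - C.d1V b with hs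
  have hsc : (s : W₂) = r - C.d1 b := rfl
  have hs0 : C.d2 s = 0 := by
    have : C.d2 (C.d1V b) = 0 := C.d2_d1 b
    rw [hs, LinearPMap.map_sub, hr0, this, sub_self]
  have hsH : (s : W₂) ∈ C.H2 := mem_H2_iff.2 ⟨⟨s.2, hs0⟩, fun v => hb _ (d1_mem_B2 v)⟩
  have hπs : (D.π2 s : W₂) = r - C.d1 (D.π1 b) := by
    rw [hs, map_sub, D.π2_eq _ hrV, Submodule.coe_sub, d1_π1_coe]
  have hsr : ‖(s : W₂)‖ ≤ ‖r‖ := by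
    refine norm_le_of_inner_self_le (norm_nonneg _) ?_
    have : inner ℝ (s : W₂) (s : W₂) = inner ℝ r (s : W₂) := by
      have := hb _ (d1_mem_B2 b)
      nth_rw 1 [hsc]
      rw [inner_sub_left, hsc, this, sub_zero]
    rw [this]
    exact real_inner_le_norm _ _
  have hbn : ‖C.d1 b‖ ≤ D.mu * ‖r‖ := by
    refine le_trans ?_ ((hD.norm_sub_π2_le_mu hsH).trans
      (mul_le_mul_of_nonneg_left hsr (mu_nonneg (D := D))))
    refine norm_le_of_inner_self_le (norm_nonneg _) ?_
    have e1 : inner ℝ (C.d1 (D.π1 b)) (C.d1 b) = 0 := by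
      have := hb _ (d1_mem_B2 (D.π1 b))
      rw [inner_sub_right, hrB _ (D.π1_mem b)] at this
      linarith
    have e2 : C.d1 b - C.d1 (D.π1 b) = -((s : W₂) - D.π2 s) := by
      rw [hπs, hsc]; abel
    have e3 : inner ℝ (C.d1 b) (C.d1 b) = inner ℝ (-((s : W₂) - D.π2 s)) (C.d1 b) := by
      rw [← e2, inner_sub_left, e1, sub_zero]
    rw [e3, ← norm_neg ((s : W₂) - D.π2 s)]
    exact real_inner_le_norm _ _
  have hkey : inner ℝ (C.d1 a) r = inner ℝ (C.d1 a - C.d1 (D.π1 a)) (C.d1 b) := by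
    have e1 := hb _ (d1_mem_B2 a)
    have e2 := hb _ (d1_mem_B2 (D.π1 a))
    have e3 := hrB _ (D.π1_mem a)
    rw [inner_sub_right] at e1 e2
    rw [inner_sub_left]
    linarith
  rw [hkey]
  exact (abs_real_inner_le_norm _ _).trans (by gcongr)

theorem IsSolution.norm_u2_error [CompleteSpace W₂] {c N : ℝ} (hc : 0 ≤ c)
    (hD : D.ProjBound N) (hB : IsClosed (C.B2 : Set W₂))
    (hP1 : D.DiscretePoincare1 c) (hP2 : D.DiscretePoincare2 c)
    (hu : C.IsSolution ν f₂ f₃ u) (hh : D.IsSolution ν f₂ f₃ uh) {v : C.d2.domain}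
    (hv : v ∈ D.V2) {a : C.d1.domain} (ha : C.d1 a = C.PB2 u.u2) :
    ‖((u.u2 - uh.u2 : C.d2.domain) : W₂)‖
      ≤ 3 * ‖((u.u2 - v : C.d2.domain) : W₂)‖ + 2 * c * ‖C.d2 (u.u2 - v)‖
        + c * ‖((u.u1 - uh.u1 : C.d1.domain) : W₁)‖
        + ‖C.d1 a - C.d1 (D.π1 a)‖ * D.mu := by
  have := D.finite_V1
  have := D.finite_V2
  have hwV : uh.u2 - v ∈ D.V2 := D.V2.sub_mem hh.2.1 hv
  obtain ⟨y, hy, hdy, hy'⟩ :=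
    C.d2.exists_orthogonal_ker_of_finiteDimensional D.V2 (uh.u2 - v) hwV
  set z := (uh.u2 - v) - y with hz
  have hzV : z ∈ D.V2 := D.V2.sub_mem hwV hy
  have hz0 : C.d2 z = 0 := by rw [hz, LinearPMap.map_sub, hdy, sub_self]
  obtain ⟨_, ⟨b, hbV, rfl⟩, hb⟩ := exists_mem_sub_orthogonal (D.V1.map C.d1.toFun) (z : W₂)
  obtain ⟨x, hxV, hdx, hx'⟩ := C.d1.exists_orthogonal_ker_of_finiteDimensional D.V1 b hbV
  have hb' : ∀ w ∈ D.V1, inner ℝ (C.d1 w) ((z : W₂) - C.d1 x) = 0 := by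
    intro w hw
    rw [hdx]
    exact hb _ ⟨w, hw, rfl⟩
  set r : C.d2.domain := z - C.d1V x with hr
  have hrc : (r : W₂) = (z : W₂) - C.d1 x := rfl
  have hrV : r ∈ D.V2 := D.V2.sub_mem hzV (D.d1_mem x hxV)
  have hdx0 : C.d2 (C.d1V x) = 0 := C.d2_d1 x
  have hr0 : C.d2 r = 0 := by rw [hr, LinearPMap.map_sub, hz0, hdx0, sub_self]
  have hrH : (r : W₂) ∈ D.H2h := mem_H2h_iff.2 ⟨⟨r.2, hrV, hr0⟩, hb'⟩
  have hsum : (uh.u2 : W₂) - v = y + C.d1 x + r := by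
    rw [hrc, hz]; simp only [Submodule.coe_sub]; abel
  have hyn : ‖(y : W₂)‖ ≤ c * (2 * ‖C.d2 (u.u2 - v)‖) := by
    refine (hP2 y hy hy').trans (mul_le_mul_of_nonneg_left ?_ hc)
    rw [hdy]
    have : uh.u2 - v = (u.u2 - v) - (u.u2 - uh.u2) := by abel
    rw [this, LinearPMap.map_sub]
    have h1 := norm_d2_u2_error hu hh hv
    exact (norm_sub_le _ _).trans (by linarith)
  have hyx : inner ℝ (y : W₂) (C.d1 x) = 0 := by
    rw [real_inner_comm]; exact hy' (C.d1V x) (D.d1_mem x hxV) hdx0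
  have hrx : inner ℝ (r : W₂) (C.d1 x) = 0 := by
    rw [real_inner_comm]; exact hb' x hxV
  have hyr : inner ℝ (y : W₂) (r : W₂) = 0 := by
    rw [real_inner_comm]; exact hy' r hrV hr0
  have hxn : ‖C.d1 x‖ ≤ ‖((u.u2 - v : C.d2.domain) : W₂)‖
      + c * ‖((u.u1 - uh.u1 : C.d1.domain) : W₁)‖ := by
    refine norm_le_of_inner_self_le (by positivity) ?_
    have e1 := hu.inner_u1 x
    have e2 := hh.inner_u1 hxV
    have e3 : inner ℝ (C.d1 x) (C.d1 x) = inner ℝ ((u.u2 - v : C.d2.domain) : W₂) (C.d1 x)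
        - inner ℝ ((u.u1 - uh.u1 : C.d1.domain) : W₁) (x : W₁) := by
      have e4 : inner ℝ ((uh.u2 : W₂) - v) (C.d1 x) = inner ℝ (C.d1 x) (C.d1 x) := by
        rw [hsum, inner_add_left, inner_add_left, hyx, hrx, zero_add, add_zero]
      rw [← e4]
      simp only [Submodule.coe_sub, inner_sub_left]
      linarith
    have i1 := real_inner_le_norm ((u.u2 - v : C.d2.domain) : W₂) (C.d1 x)
    have i2 := (neg_le_abs _).trans
      (abs_real_inner_le_norm ((u.u1 - uh.u1 : C.d1.domain) : W₁) (x : W₁))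
    have i3 := mul_le_mul_of_nonneg_left (hP1 x hxV hx')
      (norm_nonneg ((u.u1 - uh.u1 : C.d1.domain) : W₁))
    rw [e3]
    linarith
  have hrn : ‖(r : W₂)‖ ≤ ‖((u.u2 - v : C.d2.domain) : W₂)‖ + ‖C.d1 a - C.d1 (D.π1 a)‖ * D.mu := by
    have hmu := (mu_nonneg (D := D))
    refine norm_le_of_inner_self_le (by positivity) ?_
    have e1 := hh.inner_φ2 hrH
    have e2 := (hu.hodge_u2 hB).2 r hr0
    have e3 : inner ℝ (r : W₂) (r : W₂) = inner ℝ ((u.u2 - v : C.d2.domain) : W₂) (r : W₂)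
        - inner ℝ (C.d1 a) (r : W₂) := by
      have e4 : inner ℝ ((uh.u2 : W₂) - v) (r : W₂) = inner ℝ (r : W₂) (r : W₂) := by
        rw [hsum, inner_add_left, inner_add_left, hyr, hrc, hb' x hxV, zero_add, zero_add]
      rw [← e4, ha, ← e2]
      simp only [Submodule.coe_sub, inner_sub_left]
      linarith
    have i1 := real_inner_le_norm ((u.u2 - v : C.d2.domain) : W₂) (r : W₂)
    have i2 := (neg_le_abs _).trans (hD.abs_inner_d1_le hB a hrH)
    rw [e3]
    linarith
  have hsplit : ((u.u2 - uh.u2 : C.d2.domain) : W₂)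
      = ((u.u2 - v : C.d2.domain) : W₂) - ((y : W₂) + C.d1 x + r) := by
    rw [← hsum]; simp only [Submodule.coe_sub]; abel
  rw [hsplit]
  have h5 := norm_sub_le ((u.u2 - v : C.d2.domain) : W₂) ((y : W₂) + C.d1 x + r)
  have h6 := norm_add₃_le (a := (y : W₂)) (b := C.d1 x) (c := (r : W₂))
  linarith

end Discretization

end HilbertComplex

namespace HilbertComplex

variable {W₀ W₁ W₂ W₃ : Type*}
  [NormedAddCommGroup W₀] [InnerProductSpace ℝ W₀]
  [NormedAddCommGroup W₁] [InnerProductSpace ℝ W₁]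
  [NormedAddCommGroup W₂] [InnerProductSpace ℝ W₂]
  [NormedAddCommGroup W₃] [InnerProductSpace ℝ W₃]
  {C : HilbertComplex W₀ W₁ W₂ W₃} {D : C.Discretization}
  {ν : ℝ} {f₂ : W₂} {f₃ : W₃} {u uh : C.MixedTuple}

namespace Discretization

theorem bestV1_nonneg (v : C.d1.domain) : 0 ≤ D.bestV1 v :=
  Real.iInf_nonneg fun _ => add_nonneg (norm_nonneg _) (norm_nonneg _)

theorem bestV2_nonneg (v : C.d2.domain) : 0 ≤ D.bestV2 v :=
  Real.iInf_nonneg fun _ => add_nonneg (norm_nonneg _) (norm_nonneg _)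

theorem E2_nonneg (v : W₂) : 0 ≤ D.E2 v := Real.iInf_nonneg fun _ => norm_nonneg _

theorem E3_nonneg (v : W₃) : 0 ≤ D.E3 v := Real.iInf_nonneg fun _ => norm_nonneg _

/-- The error estimate on a Hilbert complex, with an explicit constant in terms of the viscosity, a
bound `N` for the projections and a Poincaré constant `k`. -/
theorem IsSolution.error_le [CompleteSpace W₁] [CompleteSpace W₂] [CompleteSpace W₃] {N k c : ℝ}
    (hν : 0 < ν) (hN : 0 ≤ N) (hk : 0 ≤ k) (hc : c = N * k) (hP1 : PoincareIneq C.d1 k)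
    (hP2 : PoincareIneq C.d2 k) (hD : D.ProjBound N)
    (hu : C.IsSolution ν f₂ f₃ u) (hh : D.IsSolution ν f₂ f₃ uh) :
    (vNorm C.d1 (u.u1 - uh.u1) + vNorm C.d2 (u.u2 - uh.u2) + ‖u.u3 - uh.u3‖)
        + (‖u.φ2 - uh.φ2‖ + ‖u.φ3 - uh.φ3‖)
      ≤ (13 + 2 * ν + 7 * c + 3 * c * ν + 2 * c ^ 2) * (1 + N)
        * (D.bestV1 u.u1 + D.bestV2 u.u2 + D.E3 u.u3 + D.E2 u.φ2 + D.E3 u.φ3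
          + D.mu * (D.E2 (C.PB2 u.u2) + D.E3 (C.PB3 u.u3))) := by
  have hc0 : 0 ≤ c := hc ▸ mul_nonneg hN hk
  have hQ1 : D.DiscretePoincare1 c := fun z hz hz' => hc ▸ hD.poincare_d1 hN hP1 hz hz'
  have hQ2 : D.DiscretePoincare2 c := fun z hz hz' => hc ▸ hD.poincare_d2 hN hP2 hz hz'
  have hB2 : IsClosed (C.B2 : Set W₂) := hP1.isClosed_range C.closed_d1
  have hB3 : IsClosed (C.B3 : Set W₃) := hP2.isClosed_range C.closed_d2
  obtain ⟨a, ha⟩ := (hu.hodge_u2 hB2).1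
  obtain ⟨w, hw⟩ := hu.exists_u3_eq hB3
  obtain ⟨hφd, hφ0⟩ := (mem_H2_iff.1 hu.1).1
  have hπφ : C.d2 (D.π2 ⟨u.φ2, hφd⟩) = 0 := by rw [D.d2_π2, hφ0, map_zero]
  have a1 := hD.vNorm_sub_π1_le hN u.u1
  have a2 := hD.vNorm_sub_π2_le hN u.u2
  have b3 := hD.norm_sub_π3_le_E3 hN u.u3
  have p2 : ‖u.φ2 - D.π2 ⟨u.φ2, hφd⟩‖ ≤ _ := hD.norm_sub_π2_le_E2 hN ⟨u.φ2, hφd⟩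
  have p3 := hD.norm_sub_π3_le_E3 hN u.φ3
  have q : ‖C.d1 a - C.d1 (D.π1 a)‖ ≤ (1 + N) * D.E2 (C.PB2 u.u2) := by
    rw [d1_π1_coe, ← ha]
    exact hD.norm_sub_π2_le_E2 hN (C.d1V a)
  have q' := mul_le_mul_of_nonneg_right q (mu_nonneg (D := D))
  have r1 := norm_d1_u1_error hν hu hh (D.π1_mem u.u1)
  have r2 := norm_d2_u2_error hu hh (D.π2_mem u.u2)
  have r3 := norm_φ3_error hu hh (D.π2_mem u.u2) (D.π3_mem u.φ3)
  have r4 := norm_φ2_error hν hu hh (D.π1_mem u.u1) (D.π2_mem ⟨u.φ2, hφd⟩) hπφ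
  have r5 := norm_u1_error hc0 hQ1 hν hu hh (D.π1_mem u.u1)
  have r6 := norm_u3_error hc0 hQ2 hν hu hh (D.π2_mem w)
  have r7 := norm_u2_error hc0 hD hB2 hQ1 hQ2 hu hh (D.π2_mem u.u2) ha
  rw [D.d2_π2, hw] at r6
  have h1 := mul_nonneg (add_nonneg zero_le_one hN) (D.bestV1_nonneg u.u1)
  have h2 := mul_nonneg (add_nonneg zero_le_one hN) (D.bestV2_nonneg u.u2)
  have h3 := mul_nonneg (add_nonneg zero_le_one hN) (D.E3_nonneg u.u3)
  have h4 := mul_nonneg (add_nonneg zero_le_one hN) (D.E2_nonneg u.φ2)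
  have h5 := mul_nonneg (add_nonneg zero_le_one hN) (D.E3_nonneg u.φ3)
  have h6 := mul_nonneg (mul_nonneg (add_nonneg zero_le_one hN) (D.E2_nonneg (C.PB2 u.u2)))
    (mu_nonneg (D := D))
  have h7 := mul_nonneg (mul_nonneg (add_nonneg zero_le_one hN) (D.E3_nonneg (C.PB3 u.u3)))
    (mu_nonneg (D := D))
  set S := (1 + N) * (D.bestV1 u.u1 + D.bestV2 u.u2 + D.E3 u.u3 + D.E2 u.φ2 + D.E3 u.φ3
          + D.mu * (D.E2 (C.PB2 u.u2) + D.E3 (C.PB3 u.u3))) with hS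
  unfold vNorm at a1 a2 ⊢
  have n1 := norm_nonneg ((u.u1 - D.π1 u.u1 : C.d1.domain) : W₁)
  have n2 := norm_nonneg (C.d1 (u.u1 - D.π1 u.u1))
  have n3 := norm_nonneg ((u.u2 - D.π2 u.u2 : C.d2.domain) : W₂)
  have n4 := norm_nonneg (C.d2 (u.u2 - D.π2 u.u2))
  have t1 : ‖C.d1 (u.u1 - D.π1 u.u1)‖ ≤ S := by linarith
  have t1ν := mul_le_mul_of_nonneg_left t1 hν.le
  have s1 : ‖C.d1 (u.u1 - uh.u1)‖ ≤ S := r1.trans t1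
  have s2 : ‖C.d2 (u.u2 - uh.u2)‖ ≤ S := by linarith
  have s3 : ‖u.φ3 - uh.φ3‖ ≤ 2 * S := by linarith
  have s4 : ‖u.φ2 - uh.φ2‖ ≤ S + 2 * (ν * S) := by linarith
  have s5 : ‖((u.u1 - uh.u1 : C.d1.domain) : W₁)‖ ≤ 2 * S + 2 * (c * S) := by
    have := mul_le_mul_of_nonneg_left t1 hc0
    linarith
  have s6 : ‖u.u3 - uh.u3‖ ≤ 2 * S + c * (ν * S + (S + 2 * (ν * S))) := by
    have e1 := mul_le_mul_of_nonneg_left s1 hν.le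
    have e2 := mul_le_mul_of_nonneg_left (add_le_add e1 s4) hc0
    linarith
  have s7 : ‖((u.u2 - uh.u2 : C.d2.domain) : W₂)‖
      ≤ 4 * S + 2 * (c * S) + c * (2 * S + 2 * (c * S)) := by
    have t2 : ‖C.d2 (u.u2 - D.π2 u.u2)‖ ≤ S := by linarith
    have e1 := mul_le_mul_of_nonneg_left t2 hc0
    have e2 := mul_le_mul_of_nonneg_left s5 hc0
    linarith
  rw [mul_assoc, ← hS]
  linarith

end Discretization

end HilbertComplex
theorem mainTheorem7 (ν κ M : ℝ) (hν : 0 < ν) :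
    ∃ K : ℝ, 0 < K ∧
      ∀ Ω : Set R3, IsOpen Ω → IsConnected Ω → Bornology.IsBounded Ω →
      ∀ C : HilbertComplex (L2s Ω) (L2v Ω) (L2v Ω) (L2s Ω),
        IsDeRham Ω C → C.CompactnessProperty → C.poincareConst ≤ κ →
      ∀ D : C.Discretization, D.ProjBound M →
      ∀ (f₂ : L2v Ω) (f₃ : L2s Ω) (u uh : C.MixedTuple),
        C.IsSolution ν f₂ f₃ u → D.IsSolution ν f₂ f₃ uh →
        (vNorm C.d1 (u.u1 - uh.u1) + vNorm C.d2 (u.u2 - uh.u2) + ‖u.u3 - uh.u3‖)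
            + (‖u.φ2 - uh.φ2‖ + ‖u.φ3 - uh.φ3‖)
          ≤ K * (D.bestV1 u.u1 + D.bestV2 u.u2 + D.E3 u.u3 + D.E2 u.φ2 + D.E3 u.φ3
              + D.mu * (D.E2 (C.PB2 u.u2) + D.E3 (C.PB3 u.u3))) := by
  set N : ℝ := |M|
  set k : ℝ := |κ| + 1
  refine ⟨(13 + 2 * ν + 7 * (N * k) + 3 * (N * k) * ν + 2 * (N * k) ^ 2) * (1 + N), by positivity,
    fun Ω _ _ _ C _ hC hκ D hD f₂ f₃ u uh hu hh => ?_⟩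
  have hlt : C.poincareConst < k := (hκ.trans (le_abs_self κ)).trans_lt (lt_add_one _)
  obtain ⟨hk, hP1, hP2⟩ := hC.poincareIneq hlt
  exact HilbertComplex.Discretization.IsSolution.error_le hν (abs_nonneg M) hk rfl hP1 hP2
    (hD.mono (le_abs_self M)) hu hh
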